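/- **Setting.** Fix real numbers $\vec p=(f_u,f_v,g_u,g_v,k)$ with $k>0$, let $M=\begin{pmatrix} f_u&f_v\\ g_u&g_v\end{pmatrix}$ and $D=\begin{pmatrix}1&0\\0&k\end{pmatrix}$, and consider the conditions (1) $f_u+g_v<0$; (2) $f_ug_v-f_vg_u>0$; (3) $(kf_u+g_v)^2-4k(f_ug_v-f_vg_u)>0$; (4) $kf_u+g_v>0$. Put $A=\dfrac{f_u+g_v}{1+k}$ and let $$a,\,b=\frac{(kf_u+g_v)\mp\sqrt{(kf_u+g_v)^2-4k(f_ug_v-f_vg_u)}}{2k}$$ ($a$ with the minus sign, $b$ with the plus sign). For $R>0$ and $\tau\in\mathbb R$, let $\operatorname{Spec}(R,\tau)$ be the set of eigenvalues $\mu$ of the free problem $u''''-\tau u''=\mu u$ on $(-R,R)$, with $u''=0$ and $u'''-\tau u'=0$ at $x=\pm R$. For $R=1$ let $\mu_0^{\rm odd}(\tau)<\mu_1^{\rm odd}(\tau)<\cdots$ be the eigenvalues with an odd eigenfunction, and $\mu_0^{\rm even}(\tau)<\mu_1^{\rm even}(\tau)<\cdots$ those with a nonconstant even eigenfunction. For $l\ge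 0$ define, in the half-plane $R>0$ of the $(R,\tau)$-plane, $$E(l)=\{R^{-4}\mu_l^{\rm even}(\tau R^2)\in(a,b)\}\cup\{R^{-4}\mu_l^{\rm even}(\tau R^2)<A,\ \tau<0\},$$ and define $O(l)$ in the same way with $\mu_l^{\rm odd}$. Let the Turing space $TS(\vec p)$ be the set of $(R,\tau)$ with $R>0$ such that all eigenvalues of $M$ have negative real part, while for some $\mu\in\operatorname{Spec}(R,\tau)$ the equation $\det(\lambda I+\mu D-M)=0$ has a root $\lambda$ with $\operatorname{Re}\lambda>0$. **Corollary 3.5 (Existence of region outside the Turing space).** If $\vec p$ satisfies (1)–(4), then there is an open connected set $U\subset\{(R,\tau): R>0,\ \tau<0\}$ whose closure contains the origin and which is disjoint from $\bigcup_{l\ge0}\big(E(l)\cup O(l)\big)$. Moreover, for every $(R,\tau)\in U$ the set $\operatorname{Spec}(R,\tau)$ contains a negative eigenvalue, and nevertheless $(R,\tau)\notin TS(\vec p)$. So negative eigenvalues alone do not force Turing instability. -/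

import Mathlib

open Set

noncomputable section

namespace FourthOrderTuring

/-- The reaction-diffusion parameter vector `p = (f_u, f_v, g_u, g_v, k)`: the partial derivatives of
the reaction kinetics at the homogeneous steady state, and the diffusivity ratio. -/
structure Params where
  fu : ℝ
  fv : ℝ
  gu : ℝ
  gv : ℝ
  k : ℝ

/-- `A(p) = (f_u + g_v) / (1 + k)`. -/
def Params.A (p : Params) : ℝ := (p.fu + p.gv) / (1 + p.k)

/-- The discriminant `(k f_u + g_v)² - 4 k (f_u g_v - f_v g_u)`. -/
def Params.disc (p : Params) : ℝ :=
  (p.k * p.fu + p.gv) ^ 2 - 4 * p.k * (p.fu * p.gv - p.fv * p.gu)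

/-- `a(p)`, the smaller root. -/
def Params.a (p : Params) : ℝ := ((p.k * p.fu + p.gv) - Real.sqrt p.disc) / (2 * p.k)

/-- `b(p)`, the larger root. -/
def Params.b (p : Params) : ℝ := ((p.k * p.fu + p.gv) + Real.sqrt p.disc) / (2 * p.k)

/-! ### The free eigenvalue problem on the interval `(-R, R)` -/

/-- `u` solves `u'''' - τ u'' = μ u` on `(-R, R)` with the natural (free) boundary conditions
`u'' = 0` and `u''' - τ u' = 0` at `x = ± R`. Functions of class `C⁴` on the closed interval are
represented by their `C⁴` extensions to the line; only the values on `[-R, R]` matter. -/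
structure SolvesFree (R τ μ : ℝ) (u : ℝ → ℝ) : Prop where
  contDiff : ContDiff ℝ 4 u
  eqn : ∀ x ∈ Ioo (-R) R, iteratedDeriv 4 u x - τ * iteratedDeriv 2 u x = μ * u x
  bc_two : ∀ x ∈ ({-R, R} : Set ℝ), iteratedDeriv 2 u x = 0
  bc_three : ∀ x ∈ ({-R, R} : Set ℝ), iteratedDeriv 3 u x - τ * deriv u x = 0

/-- `Spec((-R, R), τ)`: the eigenvalues of `d⁴/dx⁴ - τ d²/dx²` on `(-R, R)` with free boundary
conditions. -/
def freeSpectrum (R τ : ℝ) : Set ℝ :=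
  {μ | ∃ u : ℝ → ℝ, SolvesFree R τ μ u ∧ ∃ x ∈ Ioo (-R) R, u x ≠ 0}

/-- The eigenvalues on `(-1, 1)` that have a (nonzero) odd eigenfunction. -/
def oddSpectrum (τ : ℝ) : Set ℝ :=
  {μ | ∃ u : ℝ → ℝ, SolvesFree 1 τ μ u ∧ (∀ x ∈ Icc (-1 : ℝ) 1, u (-x) = -u x) ∧
    ∃ x ∈ Ioo (-1 : ℝ) 1, u x ≠ 0}

/-- The eigenvalues on `(-1, 1)` that have a nonconstant even eigenfunction. The constant mode, whose
eigenvalue is `0` for every `τ`, is not one of the even branches. -/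
def evenSpectrum (τ : ℝ) : Set ℝ :=
  {μ | ∃ u : ℝ → ℝ, SolvesFree 1 τ μ u ∧ (∀ x ∈ Icc (-1 : ℝ) 1, u (-x) = u x) ∧
    ∃ x ∈ Ioo (-1 : ℝ) 1, ∃ y ∈ Ioo (-1 : ℝ) 1, u x ≠ u y}

/-- The elements of a discrete set of reals that is bounded below, listed in increasing order. -/
def increasingList (S : Set ℝ) : ℕ → ℝ
  | 0 => sInf S
  | l + 1 => sInf {μ ∈ S | increasingList S l < μ}

/-- The eigenvalue branch `μ_l^odd(τ)` on `(-1, 1)`, `l ≥ 0` (eigenvalues with odd eigenfunctions are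
simple within that class, so listing them as a set repeats none). -/
def oddBranch (l : ℕ) (τ : ℝ) : ℝ := increasingList (oddSpectrum τ) l

/-- The eigenvalue branch `μ_l^even(τ)` on `(-1, 1)`, `l ≥ 0` (simple in the same sense). -/
def evenBranch (l : ℕ) (τ : ℝ) : ℝ := increasingList (evenSpectrum τ) l

/-! ### Instability regions in the `(R, τ)`-plane -/

/-- `E₋(l)`. -/
def Eminus (p : Params) (l : ℕ) : Set (ℝ × ℝ) :=
  {q | 0 < q.1 ∧ (q.1 ^ 4)⁻¹ * evenBranch l (q.2 * q.1 ^ 2) < p.A ∧ q.2 < 0}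

/-- `O₋(l)`. -/
def Ominus (p : Params) (l : ℕ) : Set (ℝ × ℝ) :=
  {q | 0 < q.1 ∧ (q.1 ^ 4)⁻¹ * oddBranch l (q.2 * q.1 ^ 2) < p.A ∧ q.2 < 0}

/-- `E₊(l)`. -/
def Eplus (p : Params) (l : ℕ) : Set (ℝ × ℝ) :=
  {q | 0 < q.1 ∧ (q.1 ^ 4)⁻¹ * evenBranch l (q.2 * q.1 ^ 2) ∈ Ioo p.a p.b}

/-- `O₊(l)`. -/
def Oplus (p : Params) (l : ℕ) : Set (ℝ × ℝ) :=
  {q | 0 < q.1 ∧ (q.1 ^ 4)⁻¹ * oddBranch l (q.2 * q.1 ^ 2) ∈ Ioo p.a p.b}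

/-- `E(l) = E₊(l) ∪ E₋(l)`. -/
def regionE (p : Params) (l : ℕ) : Set (ℝ × ℝ) := Eplus p l ∪ Eminus p l

/-- `O(l) = O₊(l) ∪ O₋(l)`. -/
def regionO (p : Params) (l : ℕ) : Set (ℝ × ℝ) := Oplus p l ∪ Ominus p l

/-! ### The Turing space -/

/-- The stability matrix of the reaction. -/
def Params.M (p : Params) : Matrix (Fin 2) (Fin 2) ℝ := !![p.fu, p.fv; p.gu, p.gv]

/-- The diffusivity matrix. -/
def Params.D (p : Params) : Matrix (Fin 2) (Fin 2) ℝ := !![1, 0; 0, p.k]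

/-- `lam` is a growth rate of the linearized system for a mode with diffusion eigenvalue `μ`:
`det (lam I + μ D - M) = 0`. -/
def IsGrowthRate (p : Params) (μ : ℝ) (lam : ℂ) : Prop :=
  (lam • (1 : Matrix (Fin 2) (Fin 2) ℂ) + ((μ • p.D - p.M).map Complex.ofReal)).det = 0

/-- Linear asymptotic stability of the steady state without diffusion: all eigenvalues of the
stability matrix have negative real part. -/
def StableWithoutDiffusion (p : Params) : Prop :=
  ∀ lam : ℂ, IsGrowthRate p 0 lam → lam.re < 0

/-- Linear instability of the steady state on `(-R, R)` with diffusion: some mode grows. -/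
def UnstableWithDiffusion (p : Params) (R τ : ℝ) : Prop :=
  ∃ μ ∈ freeSpectrum R τ, ∃ lam : ℂ, IsGrowthRate p μ lam ∧ 0 < lam.re

/-- `TS(p)`: the pairs `(R, τ)` for which there is Turing instability on `(-R, R)`. -/
def turingSpace (p : Params) : Set (ℝ × ℝ) :=
  {q | 0 < q.1 ∧ StableWithoutDiffusion p ∧ UnstableWithDiffusion p q.1 q.2}

end FourthOrderTuring

end

open FourthOrderTuring

/-! Dilation turns an eigenvalue on `(-R, R)` with tension `τ` into `R⁻⁴` times an eigenvalue on
`(-1, 1)` with tension `σ = τ R²`. At `σ = 0` the kernel consists of the affine functions and the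
remaining spectrum is bounded away from `0`. For small `σ < 0` this persists: the spectrum lies in
`[4σ, 0] ∪ [1/100, ∞)` (`mem_of_mem_freeSpectrum_one`).

Take `U = {0 < R < ρ, A R²/4 < τ < 0}`. Rescaled eigenvalues of the first kind are at least `4τ/R² >
A` and at most `0 < a`; those of the second kind exceed `b` once `R` is small. Hence none is below
`A` or in `(a, b)`, which gives disjointness from the regions and, through the trace and determinant
of `M - μD`, the absence of growing modes.

The negative eigenvalue is found separately, by explicit odd modes with complex exponents and the
intermediate value theorem applied to their characteristic equation. -/

namespace FourthOrderTuring

/-! ### Basic properties of solutions -/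

/-- Dilating a solution of the free problem. -/
theorem SolvesFree.comp_mul {R τ μ c : ℝ} {u : ℝ → ℝ} (h : SolvesFree R τ μ u) (hc : 0 < c) :
    SolvesFree (R / c) (τ * c ^ 2) (μ * c ^ 4) (fun x => u (c * x)) := by
  have hd : ∀ n : ℕ, n ≤ 4 → iteratedDeriv n (fun x => u (c * x)) =
      fun x => c ^ n * iteratedDeriv n u (c * x) := fun n hn =>
    iteratedDeriv_comp_const_mul (h.contDiff.of_le (by exact_mod_cast hn)) c
  have hd1 : deriv (fun x => u (c * x)) = fun x => c ^ 1 * deriv u (c * x) := by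
    simpa only [iteratedDeriv_one] using hd 1 (by norm_num)
  have hmem : ∀ x ∈ ({-(R / c), R / c} : Set ℝ), c * x ∈ ({-R, R} : Set ℝ) := by
    rintro x (rfl | rfl)
    · left; field_simp
    · right; exact mul_div_cancel₀ R hc.ne'
  refine ⟨h.contDiff.comp (contDiff_const.mul contDiff_id), fun x hx => ?_, fun x hx => ?_,
    fun x hx => ?_⟩
  · have hx' : c * x ∈ Ioo (-R) R := by
      have h1 := hx.1
      have h2 := hx.2
      rw [← neg_div, div_lt_iff₀ hc] at h1
      rw [lt_div_iff₀ hc] at h2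
      constructor <;> linarith
    rw [hd 4 le_rfl, hd 2 (by norm_num)]
    linear_combination c ^ 4 * h.eqn _ hx'
  · rw [hd 2 (by norm_num)]
    simp only [h.bc_two _ (hmem x hx), mul_zero]
  · rw [hd 3 (by norm_num), hd1]
    linear_combination c ^ 3 * h.bc_three _ (hmem x hx)

theorem mem_freeSpectrum_dilate {R τ μ c : ℝ} (hc : 0 < c) (h : μ ∈ freeSpectrum R τ) :
    μ * c ^ 4 ∈ freeSpectrum (R / c) (τ * c ^ 2) := by
  obtain ⟨u, hu, x, hx, hne⟩ := h
  refine ⟨_, hu.comp_mul hc, x / c, ⟨?_, ?_⟩, ?_⟩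
  · rw [← neg_div]; exact (div_lt_div_iff_of_pos_right hc).2 hx.1
  · exact (div_lt_div_iff_of_pos_right hc).2 hx.2
  · simpa only [mul_div_cancel₀ x hc.ne'] using hne

theorem oddSpectrum_subset (τ : ℝ) : oddSpectrum τ ⊆ freeSpectrum 1 τ := by
  rintro μ ⟨u, hu, -, h⟩
  exact ⟨u, hu, h⟩

theorem evenSpectrum_subset (τ : ℝ) : evenSpectrum τ ⊆ freeSpectrum 1 τ := by
  rintro μ ⟨u, hu, -, x, hx, y, hy, hxy⟩
  by_cases h : u x = 0
  · exact ⟨u, hu, y, hy, fun h' => hxy (h.trans h'.symm)⟩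
  · exact ⟨u, hu, x, hx, h⟩

theorem SolvesFree.hasDerivAt {R τ μ : ℝ} {u : ℝ → ℝ} (h : SolvesFree R τ μ u) {n : ℕ}
    (hn : n < 4) (x : ℝ) : HasDerivAt (iteratedDeriv n u) (iteratedDeriv (n + 1) u x) x := by
  rw [iteratedDeriv_succ]
  exact (h.contDiff.differentiable_iteratedDeriv n (by exact_mod_cast hn) x).hasDerivAt

theorem SolvesFree.continuous {R τ μ : ℝ} {u : ℝ → ℝ} (h : SolvesFree R τ μ u) {n : ℕ}
    (hn : n ≤ 4) : Continuous (iteratedDeriv n u) :=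
  h.contDiff.continuous_iteratedDeriv n (by exact_mod_cast hn)

/-- The equation extends to the closed interval. -/
theorem SolvesFree.eqn_Icc {τ μ : ℝ} {u : ℝ → ℝ} (h : SolvesFree 1 τ μ u) {x : ℝ}
    (hx : x ∈ Icc (-1 : ℝ) 1) : iteratedDeriv 4 u x - τ * iteratedDeriv 2 u x = μ * u x := by
  have hcl : IsClosed {x | iteratedDeriv 4 u x - τ * iteratedDeriv 2 u x = μ * u x} :=
    isClosed_eq ((h.continuous le_rfl).sub (continuous_const.mul (h.continuous (by norm_num))))
      (continuous_const.mul h.contDiff.continuous)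
  rw [← closure_Ioo (by norm_num : (-1 : ℝ) ≠ 1)] at hx
  exact closure_minimal (fun y hy => h.eqn y hy) hcl hx

/-- The weak form of the free problem. -/
theorem SolvesFree.weak {τ μ : ℝ} {u φ φ₁ φ₂ : ℝ → ℝ} (h : SolvesFree 1 τ μ u)
    (hφ : ∀ x, HasDerivAt φ (φ₁ x) x) (hφ₁ : ∀ x, HasDerivAt φ₁ (φ₂ x) x) (hφ₂ : Continuous φ₂) :
    (∫ x in (-1 : ℝ)..1, iteratedDeriv 2 u x * φ₂ x) +
      τ * (∫ x in (-1 : ℝ)..1, iteratedDeriv 1 u x * φ₁ x) =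
      μ * ∫ x in (-1 : ℝ)..1, u x * φ x := by
  have c : Continuous φ := continuous_iff_continuousAt.2 fun x => (hφ x).continuousAt
  have c₁ : Continuous φ₁ := continuous_iff_continuousAt.2 fun x => (hφ₁ x).continuousAt
  have hu := h.contDiff.continuous
  have hu1 := h.continuous (n := 1) (by norm_num)
  have hu2 := h.continuous (n := 2) (by norm_num)
  have key : ∫ x in (-1 : ℝ)..1, (μ * (u x * φ x) -
      (iteratedDeriv 2 u x * φ₂ x + τ * (iteratedDeriv 1 u x * φ₁ x))) = 0 := by
    -- The integrand is an exact derivative. The free conditions kill both boundary terms, so the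
    -- test function needs none.
    rw [intervalIntegral.integral_eq_sub_of_hasDerivAt
      (f := fun x => (iteratedDeriv 3 u x - τ * iteratedDeriv 1 u x) * φ x -
        iteratedDeriv 2 u x * φ₁ x)]
    · have e1 := h.bc_three 1 (by simp)
      have e2 := h.bc_three (-1) (by simp)
      have e3 := h.bc_two 1 (by simp)
      have e4 := h.bc_two (-1) (by simp)
      rw [← iteratedDeriv_one] at e1 e2
      simp only [e1, e2, e3, e4, zero_mul, sub_zero]
    · intro x hx
      rw [uIcc_of_le (by norm_num)] at hx
      have d := (((h.hasDerivAt (n := 3) (by norm_num) x).sub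
        ((h.hasDerivAt (n := 1) (by norm_num) x).const_mul τ)).mul (hφ x)).sub
        ((h.hasDerivAt (n := 2) (by norm_num) x).mul (hφ₁ x))
      refine d.congr_deriv ?_
      have e := h.eqn_Icc hx
      simp only [Pi.sub_apply]
      linear_combination φ x * e
    · exact Continuous.intervalIntegrable (by fun_prop) _ _
  rw [intervalIntegral.integral_sub, intervalIntegral.integral_add,
    intervalIntegral.integral_const_mul, intervalIntegral.integral_const_mul] at key
  · linarith
  all_goals exact Continuous.intervalIntegrable (by fun_prop) _ _

/-! ### A Poincaré inequality -/

/-- The `L¹` norm on `(-1, 1)` is at most `√2` times the `L²` norm. -/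
theorem sq_integral_abs_le {g : ℝ → ℝ} (hg : Continuous g) :
    (∫ x in (-1 : ℝ)..1, |g x|) ^ 2 ≤ 2 * ∫ x in (-1 : ℝ)..1, g x * g x := by
  set L := ∫ x in (-1 : ℝ)..1, |g x| with hL
  -- `L / 2` is the mean of `|g|`, so this is the nonnegativity of a variance.
  have h0 : 0 ≤ ∫ x in (-1 : ℝ)..1, (|g x| - L / 2) ^ 2 :=
    intervalIntegral.integral_nonneg (by norm_num) fun x _ => sq_nonneg _
  have h1 : ∫ x in (-1 : ℝ)..1, (|g x| - L / 2) ^ 2 =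
      ∫ x in (-1 : ℝ)..1, (g x * g x - L * |g x| + L ^ 2 / 4) := by
    congr 1; ext x
    linear_combination abs_mul_abs_self (g x)
  rw [h1, intervalIntegral.integral_add, intervalIntegral.integral_sub,
    intervalIntegral.integral_const_mul, ← hL, intervalIntegral.integral_const, smul_eq_mul] at h0
  · nlinarith
  all_goals exact Continuous.intervalIntegrable (by fun_prop) _ _

/-- A function on `[-1, 1]` that is orthogonal to the affine functions is controlled, together with
its derivative, by its second derivative. -/
theorem abs_le_of_orthogonal_affine {v v₁ v₂ : ℝ → ℝ} (hv : ∀ x, HasDerivAt v (v₁ x) x)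
    (hv₁ : ∀ x, HasDerivAt v₁ (v₂ x) x) (hv₂ : Continuous v₂)
    (h0 : ∫ x in (-1 : ℝ)..1, v x = 0) (h1 : ∫ x in (-1 : ℝ)..1, v x * x = 0) {x : ℝ}
    (hx : x ∈ Icc (-1 : ℝ) 1) :
    |v x| ≤ 3 * ∫ y in (-1 : ℝ)..1, |v₂ y| ∧ |v₁ x| ≤ 2 * ∫ y in (-1 : ℝ)..1, |v₂ y| := by
  set L := ∫ y in (-1 : ℝ)..1, |v₂ y| with hL
  have c : Continuous v := continuous_iff_continuousAt.2 fun x => (hv x).continuousAt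
  have hz : (0 : ℝ) ∈ Icc (-1 : ℝ) 1 := by constructor <;> norm_num
  have hL0 : 0 ≤ L := intervalIntegral.integral_nonneg (by norm_num) fun x _ => abs_nonneg _
  have hosc : ∀ x ∈ Icc (-1 : ℝ) 1, |v₁ x - v₁ 0| ≤ L := by
    intro x hx
    rw [← intervalIntegral.integral_eq_sub_of_hasDerivAt (fun y _ => hv₁ y)
      (hv₂.intervalIntegrable _ _)]
    refine (intervalIntegral.norm_integral_le_abs_integral_norm (f := v₂)).trans ?_
    simp only [Real.norm_eq_abs]
    rcases le_total 0 x with h | h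
    · rw [abs_of_nonneg (intervalIntegral.integral_nonneg h fun y _ => abs_nonneg _)]
      exact intervalIntegral.integral_mono_interval (by norm_num) h hx.2
        (Filter.Eventually.of_forall fun y => abs_nonneg _) (hv₂.abs.intervalIntegrable _ _)
    · rw [intervalIntegral.integral_symm, abs_neg,
        abs_of_nonneg (intervalIntegral.integral_nonneg h fun y _ => abs_nonneg _)]
      exact intervalIntegral.integral_mono_interval hx.1 h (by norm_num)
        (Filter.Eventually.of_forall fun y => abs_nonneg _) (hv₂.abs.intervalIntegrable _ _)
  have he : ∀ x ∈ Icc (-1 : ℝ) 1, |v x - v 0 - v₁ 0 * x| ≤ L * |x| := by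
    intro x hx
    have := Convex.norm_image_sub_le_of_norm_hasDerivWithin_le
      (f := fun y => v y - v₁ 0 * y) (f' := fun y => v₁ y - v₁ 0 * 1) (C := L) (s := Icc (-1) 1)
      (fun y _ => ((hv y).sub ((hasDerivAt_id y).const_mul (v₁ 0))).hasDerivWithinAt)
      (fun y hy => by rw [mul_one]; exact hosc y hy) (convex_Icc _ _) hz hx
    simp only [Real.norm_eq_abs, mul_zero, sub_zero] at this
    convert this using 2
    ring
  -- The error of the tangent line at `0` is at most `L|x|`. Pairing it with `x`, and below with
  -- `1`, leaves only the slope or only the value of that line, by orthogonality of `v`.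
  have hm : |v₁ 0| ≤ L := by
    have e : (∫ x in (-1 : ℝ)..1, (v x - v 0 - v₁ 0 * x) * x) = -(2 / 3 * v₁ 0) := by
      have : ∀ x : ℝ, (v x - v 0 - v₁ 0 * x) * x = v x * x - v 0 * x - v₁ 0 * x ^ 2 :=
        fun x => by ring
      simp only [this]
      rw [intervalIntegral.integral_sub, intervalIntegral.integral_sub, h1,
        intervalIntegral.integral_const_mul, intervalIntegral.integral_const_mul, integral_id,
        integral_pow]
      · norm_num
        ring
      all_goals exact Continuous.intervalIntegrable (by fun_prop) _ _
    have b : |∫ x in (-1 : ℝ)..1, (v x - v 0 - v₁ 0 * x) * x| ≤ ∫ x in (-1 : ℝ)..1, L * x ^ 2 := by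
      refine (intervalIntegral.abs_integral_le_integral_abs (by norm_num)).trans
        (intervalIntegral.integral_mono_on (by norm_num)
          (Continuous.intervalIntegrable (by fun_prop) _ _)
          (Continuous.intervalIntegrable (by fun_prop) _ _) fun x hx => ?_)
      rw [abs_mul, ← sq_abs x]
      nlinarith [mul_le_mul_of_nonneg_right (he x hx) (abs_nonneg x)]
    rw [e, abs_neg, abs_mul, intervalIntegral.integral_const_mul, integral_pow] at b
    norm_num at b
    linarith
  have hv0 : |v 0| ≤ L := by
    have e : (∫ x in (-1 : ℝ)..1, (v x - v 0 - v₁ 0 * x)) = -(2 * v 0) := by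
      rw [intervalIntegral.integral_sub, intervalIntegral.integral_sub, h0,
        intervalIntegral.integral_const_mul, intervalIntegral.integral_const, integral_id]
      · norm_num
      all_goals exact Continuous.intervalIntegrable (by fun_prop) _ _
    have b : |∫ x in (-1 : ℝ)..1, (v x - v 0 - v₁ 0 * x)| ≤ ∫ x in (-1 : ℝ)..1, L := by
      refine (intervalIntegral.abs_integral_le_integral_abs (by norm_num)).trans
        (intervalIntegral.integral_mono_on (by norm_num)
          (Continuous.intervalIntegrable (by fun_prop) _ _)
          (Continuous.intervalIntegrable (by fun_prop) _ _) fun x hx => (he x hx).trans ?_)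
      exact mul_le_of_le_one_right hL0 (abs_le.2 hx)
    rw [e, abs_neg, abs_mul, intervalIntegral.integral_const, smul_eq_mul, abs_two] at b
    linarith
  have hx1 : |x| ≤ 1 := abs_le.2 hx
  constructor
  · have t1 : |v₁ 0 * x| ≤ L := by
      rw [abs_mul]
      exact (mul_le_of_le_one_right (abs_nonneg _) hx1).trans hm
    have t2 := (he x hx).trans (mul_le_of_le_one_right hL0 hx1)
    rw [abs_le] at *
    constructor <;> linarith
  · have t := hosc x hx
    rw [abs_le] at *
    constructor <;> linarith

/-! ### The spectral gap -/

/-- For small negative `σ`, an eigenvalue on `(-1, 1)` is either slightly negative, of size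
`O(|σ|)`, or zero, or bounded below by a positive constant. -/
theorem mem_of_mem_freeSpectrum_one {σ μ : ℝ} (hσ : σ < 0) (hσ' : -(1 / 200) < σ)
    (hμ : μ ∈ freeSpectrum 1 σ) : μ ∈ Icc (4 * σ) 0 ∪ Ici (1 / 100) := by
  by_contra hnot
  simp only [mem_union, mem_Icc, mem_Ici, not_or, not_le] at hnot
  obtain ⟨hn, hμ1⟩ := hnot
  obtain ⟨u, h, x₀, hx₀, hne⟩ := hμ
  have hμ0 : μ ≠ 0 := by
    rintro rfl
    exact hn ⟨by linarith, le_rfl⟩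
  have hu := h.contDiff.continuous
  have hu1 := h.continuous (n := 1) (by norm_num)
  have hu2 := h.continuous (n := 2) (by norm_num)
  have d0 : ∀ x, HasDerivAt u (iteratedDeriv 1 u x) x := fun x => by
    simpa using h.hasDerivAt (n := 0) (by norm_num) x
  have d1 : ∀ x, HasDerivAt (iteratedDeriv 1 u) (iteratedDeriv 2 u x) x :=
    fun x => h.hasDerivAt (n := 1) (by norm_num) x
  -- The weak form is tested with `1`, `x` and later `v`, the part of `u` orthogonal to affine
  -- functions.
  have mean : ∫ x in (-1 : ℝ)..1, u x = 0 := by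
    have := h.weak (φ := fun _ => 1) (φ₁ := fun _ => 0) (φ₂ := fun _ => 0)
      (fun x => hasDerivAt_const x 1) (fun x => hasDerivAt_const x 0) continuous_const
    simpa [hμ0] using this
  have moment : σ * (u 1 - u (-1)) = μ * ∫ x in (-1 : ℝ)..1, u x * x := by
    have := h.weak (φ := fun x => x) (φ₁ := fun _ => 1) (φ₂ := fun _ => 0)
      (fun x => hasDerivAt_id x) (fun x => hasDerivAt_const x 1) continuous_const
    rw [← this, ← intervalIntegral.integral_eq_sub_of_hasDerivAt (fun y _ => d0 y)
      (hu1.intervalIntegrable _ _)]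
    simp
  -- `c x` is the projection of `u` onto `x`, as `∫ x² = 2/3`; the constant part vanishes by `mean`.
  obtain ⟨c, hc⟩ : ∃ c, c = 3 / 2 * ∫ x in (-1 : ℝ)..1, u x * x := ⟨_, rfl⟩
  obtain ⟨v, hv⟩ : ∃ v : ℝ → ℝ, v = fun x => u x - c * x := ⟨_, rfl⟩
  obtain ⟨v₁, hv₁⟩ : ∃ v₁ : ℝ → ℝ, v₁ = fun x => iteratedDeriv 1 u x - c := ⟨_, rfl⟩
  have cv : Continuous v := by rw [hv]; fun_prop
  have cv1 : Continuous v₁ := by rw [hv₁]; fun_prop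
  have e0 : ∀ x, HasDerivAt v (v₁ x) x := fun x => by
    rw [hv, hv₁]
    exact ((d0 x).fun_sub ((hasDerivAt_id' x).const_mul c)).congr_deriv (by rw [mul_one])
  have e1 : ∀ x, HasDerivAt v₁ (iteratedDeriv 2 u x) x := fun x => by
    rw [hv₁]
    exact (d1 x).sub_const c
  have v0 : ∫ x in (-1 : ℝ)..1, v x = 0 := by
    rw [hv, intervalIntegral.integral_sub (hu.intervalIntegrable _ _)
      (Continuous.intervalIntegrable (by fun_prop) _ _), mean, intervalIntegral.integral_const_mul,
      integral_id]
    norm_num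
  have vx : ∫ x in (-1 : ℝ)..1, v x * x = 0 := by
    have : ∀ x, v x * x = u x * x - c * x ^ 2 := fun x => by rw [hv]; ring
    simp only [this]
    rw [intervalIntegral.integral_sub, intervalIntegral.integral_const_mul, integral_pow, hc]
    · norm_num
      ring
    all_goals exact Continuous.intervalIntegrable (by fun_prop) _ _
  have energy := h.weak e0 e1 hu2
  have i1 : ∫ x in (-1 : ℝ)..1, iteratedDeriv 1 u x * v₁ x =
      (∫ x in (-1 : ℝ)..1, v₁ x * v₁ x) + c * (v 1 - v (-1)) := by
    rw [← intervalIntegral.integral_eq_sub_of_hasDerivAt (fun y _ => e0 y)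
      (cv1.intervalIntegrable _ _), ← intervalIntegral.integral_const_mul,
      ← intervalIntegral.integral_add]
    · congr 1; ext x
      rw [hv₁]; ring
    all_goals exact Continuous.intervalIntegrable (by fun_prop) _ _
  have i0 : ∫ x in (-1 : ℝ)..1, u x * v x = ∫ x in (-1 : ℝ)..1, v x * v x := by
    have : ∀ x, u x * v x = v x * v x + c * (v x * x) := fun x => by rw [hv]; ring
    simp only [this]
    rw [intervalIntegral.integral_add, intervalIntegral.integral_const_mul, vx, mul_zero, add_zero]
    all_goals exact Continuous.intervalIntegrable (by fun_prop) _ _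
  rw [i1, i0] at energy
  obtain ⟨L, hL⟩ : ∃ L, L = ∫ y in (-1 : ℝ)..1, |iteratedDeriv 2 u y| := ⟨_, rfl⟩
  have hLN := sq_integral_abs_le hu2
  have bound := fun x hx => abs_le_of_orthogonal_affine e0 e1 hu2 v0 vx (x := x) hx
  rw [← hL] at hLN
  simp only [← hL] at bound
  have hL0 : 0 ≤ L := hL ▸ intervalIntegral.integral_nonneg (by norm_num) fun x _ => abs_nonneg _
  have bv : ∫ x in (-1 : ℝ)..1, v x * v x ≤ 18 * L ^ 2 := by
    have : ∫ x in (-1 : ℝ)..1, v x * v x ≤ ∫ x in (-1 : ℝ)..1, (9 * L ^ 2) := by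
      refine intervalIntegral.integral_mono_on (by norm_num)
        (Continuous.intervalIntegrable (by fun_prop) _ _) (by simp) fun x hx => ?_
      have := (bound x hx).1
      rw [← abs_mul_abs_self]
      nlinarith [abs_nonneg (v x)]
    rw [intervalIntegral.integral_const, smul_eq_mul] at this
    linarith
  have bv1 : ∫ x in (-1 : ℝ)..1, v₁ x * v₁ x ≤ 8 * L ^ 2 := by
    have : ∫ x in (-1 : ℝ)..1, v₁ x * v₁ x ≤ ∫ x in (-1 : ℝ)..1, (4 * L ^ 2) := by
      refine intervalIntegral.integral_mono_on (by norm_num)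
        (Continuous.intervalIntegrable (by fun_prop) _ _) (by simp) fun x hx => ?_
      have := (bound x hx).2
      rw [← abs_mul_abs_self]
      nlinarith [abs_nonneg (v₁ x)]
    rw [intervalIntegral.integral_const, smul_eq_mul] at this
    linarith
  have pv : 0 ≤ ∫ x in (-1 : ℝ)..1, v x * v x :=
    intervalIntegral.integral_nonneg (by norm_num) fun x _ => mul_self_nonneg _
  have pv1 : 0 ≤ ∫ x in (-1 : ℝ)..1, v₁ x * v₁ x :=
    intervalIntegral.integral_nonneg (by norm_num) fun x _ => mul_self_nonneg _
  obtain ⟨w, hw⟩ : ∃ w, w = v 1 - v (-1) := ⟨_, rfl⟩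
  have bw : w ^ 2 ≤ 36 * L ^ 2 := by
    have a1 := abs_le.1 (bound 1 (by norm_num)).1
    have a2 := abs_le.1 (bound (-1) (by norm_num)).1
    nlinarith
  have hcw : (2 / 3 * μ - 2 * σ) * c = σ * w := by
    have : u 1 - u (-1) = w + 2 * c := by rw [hw, hv]; ring
    rw [this] at moment
    linear_combination -moment + 2 / 3 * μ * hc
  have hμc : 0 < μ ∨ μ < 4 * σ := by
    rcases lt_or_ge 0 μ with h' | h'
    · exact Or.inl h'
    · exact Or.inr (lt_of_not_ge fun h4 => hn ⟨h4, h'⟩)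
  -- By `hcw`, `c` is a multiple of `w`, singular only at `μ = 3σ`, the Rayleigh quotient of `x`.
  -- Excluding `[4σ, 0]` keeps `μ` away from it: the factor is nonpositive for `μ > 0` and at most
  -- `3/2` for `μ < 4σ`.
  have bc : c * w ≤ 3 / 2 * w ^ 2 ∧ (w = 0 → c = 0) := by
    have hK : 2 / 3 * μ - 2 * σ ≠ 0 := by
      rcases hμc with h' | h'
      · exact (by linarith : (0 : ℝ) < 2 / 3 * μ - 2 * σ).ne'
      · exact (by linarith : 2 / 3 * μ - 2 * σ < 0).ne
    have hc' : c = σ / (2 / 3 * μ - 2 * σ) * w := by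
      rw [div_mul_eq_mul_div, eq_div_iff hK]
      linear_combination hcw
    have hq : σ / (2 / 3 * μ - 2 * σ) ≤ 3 / 2 := by
      rcases hμc with h' | h'
      · exact (div_nonpos_of_nonpos_of_nonneg hσ.le (by linarith)).trans (by norm_num)
      · rw [div_le_iff_of_neg (by linarith)]
        linarith
    refine ⟨?_, fun h' => by rw [hc', h', mul_zero]⟩
    rw [hc']
    nlinarith [sq_nonneg w]
  rw [← hw] at energy
  -- The energy identity gives `∫ u''² ≤ (18/100 + 62/200) L² = 0.49 L²`, with `62 = 8 + 54` from
  -- `bv1`, `bc` and `bw`, whereas `∫ u''² ≥ L²/2`.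
  have hLz : L = 0 := by
    have t1 : μ * (∫ x in (-1 : ℝ)..1, v x * v x) ≤ 1 / 100 * (18 * L ^ 2) :=
      (mul_le_mul_of_nonneg_right hμ1.le pv).trans (by linarith)
    have t2 : (∫ x in (-1 : ℝ)..1, v₁ x * v₁ x) + c * w ≤ 62 * L ^ 2 := by linarith [bc.1]
    have t3 : -σ * ((∫ x in (-1 : ℝ)..1, v₁ x * v₁ x) + c * w) ≤ -σ * (62 * L ^ 2) :=
      mul_le_mul_of_nonneg_left t2 (by linarith)
    have t4 : -σ * (62 * L ^ 2) ≤ 1 / 200 * (62 * L ^ 2) :=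
      mul_le_mul_of_nonneg_right (by linarith) (by positivity)
    have : L ^ 2 ≤ 0 := by linarith
    exact pow_eq_zero_iff two_ne_zero |>.1 (le_antisymm this (sq_nonneg L))
  rw [hLz] at bound bw
  have hw0 : w = 0 := pow_eq_zero_iff two_ne_zero |>.1
    (le_antisymm (by simpa using bw) (sq_nonneg w))
  have hvz := (bound x₀ (Ioo_subset_Icc_self hx₀)).1
  rw [mul_zero, abs_nonpos_iff, hv, bc.2 hw0] at hvz
  exact hne (by simpa using hvz)

/-! ### Listing a set -/

/-- Each entry is an infimum, hence in the closure of a subset of `C`, or is the default `sInf ∅ =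
0`. Thanks to `h0`, no branch has to be shown to exist. -/
theorem increasingList_mem {S C : Set ℝ} (hS : S ⊆ C) (hC : IsClosed C) (h0 : 0 ∈ C)
    (hb : BddBelow C) (l : ℕ) : increasingList S l ∈ C := by
  have key : ∀ T ⊆ C, sInf T ∈ C := by
    intro T hT
    rcases T.eq_empty_or_nonempty with rfl | hne
    · rwa [Real.sInf_empty]
    · exact closure_minimal hT hC (csInf_mem_closure hne (hb.mono hT))
  cases l with
  | zero => exact key S hS
  | succ l => exact key _ fun μ hμ => hS hμ.1

/-! ### A negative eigenvalue -/

/-- The odd functions in the span of the products of `exp (± p x)` with `cos (q x)`, `sin (q x)`. -/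
noncomputable def oddMode (p q α β : ℝ) (x : ℝ) : ℝ :=
  α * (Real.sinh (p * x) * Real.cos (q * x)) + β * (Real.cosh (p * x) * Real.sin (q * x))

/-- The even functions in the span of the products of `exp (± p x)` with `cos (q x)`, `sin (q x)`. -/
noncomputable def evenMode (p q α β : ℝ) (x : ℝ) : ℝ :=
  α * (Real.cosh (p * x) * Real.cos (q * x)) + β * (Real.sinh (p * x) * Real.sin (q * x))

/-- Differentiation exchanges the two families and multiplies `α + iβ` by `p - iq`. -/
theorem deriv_oddMode (p q α β : ℝ) :
    deriv (oddMode p q α β) = evenMode p q (α * p + β * q) (β * p - α * q) := by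
  ext x
  have hp : HasDerivAt (fun x : ℝ => p * x) p x := by simpa using (hasDerivAt_id x).const_mul p
  have hq : HasDerivAt (fun x : ℝ => q * x) q x := by simpa using (hasDerivAt_id x).const_mul q
  have h := ((hp.sinh.fun_mul hq.cos).const_mul α).fun_add ((hp.cosh.fun_mul hq.sin).const_mul β)
  refine h.deriv.trans ?_
  simp only [evenMode]
  ring

theorem deriv_evenMode (p q α β : ℝ) :
    deriv (evenMode p q α β) = oddMode p q (α * p + β * q) (β * p - α * q) := by
  ext x
  have hp : HasDerivAt (fun x : ℝ => p * x) p x := by simpa using (hasDerivAt_id x).const_mul p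
  have hq : HasDerivAt (fun x : ℝ => q * x) q x := by simpa using (hasDerivAt_id x).const_mul q
  have h := ((hp.cosh.fun_mul hq.cos).const_mul α).fun_add ((hp.sinh.fun_mul hq.sin).const_mul β)
  refine h.deriv.trans ?_
  simp only [oddMode]
  ring

theorem contDiff_oddMode (p q α β : ℝ) : ContDiff ℝ 4 (oddMode p q α β) := by
  unfold oddMode
  fun_prop

theorem oddMode_neg (p q α β x : ℝ) : oddMode p q α β (-x) = -oddMode p q α β x := by
  simp only [oddMode, mul_neg, Real.sinh_neg, Real.cosh_neg, Real.sin_neg, Real.cos_neg]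
  ring

theorem evenMode_neg (p q α β x : ℝ) : evenMode p q α β (-x) = evenMode p q α β x := by
  simp only [evenMode, mul_neg, Real.sinh_neg, Real.cosh_neg, Real.sin_neg, Real.cos_neg]
  ring

theorem evenMode_zero (p q α β : ℝ) : evenMode p q α β 0 = α := by
  simp [evenMode]

/-- An odd mode with nonzero coefficients is not identically zero near the origin. -/
theorem exists_oddMode_ne_zero {p q α β : ℝ} (hp : p ≠ 0) (hq : q ≠ 0) (h : α ≠ 0 ∨ β ≠ 0) :
    ∃ x ∈ Ioo (-1 : ℝ) 1, oddMode p q α β x ≠ 0 := by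
  by_contra! hz
  have hev : oddMode p q α β =ᶠ[nhds 0] fun _ => 0 := by
    filter_upwards [Ioo_mem_nhds (by norm_num : (-1 : ℝ) < 0) one_pos] with x hx using hz x hx
  have h1 := hev.iteratedDeriv_eq 1
  have h3 := hev.iteratedDeriv_eq 3
  simp only [iteratedDeriv_succ, iteratedDeriv_zero, deriv_oddMode, deriv_evenMode, deriv_const',
    evenMode_zero] at h1 h3
  have hpq : p * q ≠ 0 := mul_ne_zero hp hq
  have e : β * p - α * q = 0 := by
    refine (mul_eq_zero.1 (?_ : (2 * (p * q)) * _ = 0)).resolve_left (mul_ne_zero two_ne_zero hpq)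
    linear_combination h3 - (p ^ 2 - q ^ 2) * h1
  have hs : p ^ 2 + q ^ 2 ≠ 0 := by positivity
  have hα : α = 0 := by
    refine (mul_eq_zero.1 (?_ : (p ^ 2 + q ^ 2) * _ = 0)).resolve_left hs
    linear_combination p * h1 - q * e
  have hβ : β = 0 := by
    refine (mul_eq_zero.1 (?_ : (p ^ 2 + q ^ 2) * _ = 0)).resolve_left hs
    linear_combination q * h1 + p * e
  exact h.elim (fun h => h hα) fun h => h hβ

/-- The characteristic equation for odd eigenfunctions with complex exponents `± p ± i q`. -/
theorem neg_mem_freeSpectrum_of_root {p q : ℝ} (hp : p ≠ 0) (hq : q ≠ 0) (hq' : Real.sin q ≠ 0)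
    (hroot : (p ^ 3 - 3 * p * q ^ 2) * Real.sin (2 * q) +
      (3 * p ^ 2 * q - q ^ 3) * Real.sinh (2 * p) = 0) :
    -(p ^ 2 + q ^ 2) ^ 2 ∈ freeSpectrum 1 (2 * (p ^ 2 - q ^ 2)) := by
  obtain ⟨C, hC⟩ : ∃ C, C = Real.cosh p * Real.sin q := ⟨_, rfl⟩
  obtain ⟨D, hD⟩ : ∃ D, D = -(Real.sinh p * Real.cos q) := ⟨_, rfl⟩
  -- `α + iβ = (p + iq)² (C + iD)`, so `u''` has coefficients `(p² + q²)² (C, D)`, and `C`, `D` are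
  -- chosen to make it vanish at `1`. The other boundary condition is then `hroot`.
  obtain ⟨α, hα⟩ : ∃ α, α = (p ^ 2 - q ^ 2) * C - 2 * p * q * D := ⟨_, rfl⟩
  obtain ⟨β, hβ⟩ : ∃ β, β = (p ^ 2 - q ^ 2) * D + 2 * p * q * C := ⟨_, rfl⟩
  have hC0 : C ≠ 0 := by rw [hC]; exact mul_ne_zero (Real.cosh_pos p).ne' hq'
  have hch := Real.cosh_sq p
  have hsn := Real.sin_sq_add_cos_sq q
  rw [Real.sin_two_mul, Real.sinh_two_mul] at hroot
  have b2 : iteratedDeriv 2 (oddMode p q α β) 1 = 0 := by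
    simp only [iteratedDeriv_succ, iteratedDeriv_zero, deriv_oddMode, deriv_evenMode, oddMode,
      mul_one]
    rw [hα, hβ, hC, hD]
    ring
  have b3 : iteratedDeriv 3 (oddMode p q α β) 1 -
      2 * (p ^ 2 - q ^ 2) * deriv (oddMode p q α β) 1 = 0 := by
    simp only [iteratedDeriv_succ, iteratedDeriv_zero, deriv_oddMode, deriv_evenMode, evenMode,
      mul_one]
    rw [hα, hβ, hC, hD]
    linear_combination -(p ^ 2 + q ^ 2) / 2 * hroot
      - (p ^ 2 + q ^ 2) * (p ^ 3 - 3 * p * q ^ 2) * Real.sin q * Real.cos q * hch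
      - (p ^ 2 + q ^ 2) * (3 * p ^ 2 * q - q ^ 3) * Real.sinh p * Real.cosh p * hsn
  refine ⟨oddMode p q α β, ⟨contDiff_oddMode _ _ _ _, fun x _ => ?_, ?_, ?_⟩,
    exists_oddMode_ne_zero hp hq ?_⟩
  · simp only [iteratedDeriv_succ, iteratedDeriv_zero, deriv_oddMode, deriv_evenMode, oddMode]
    ring
  · rintro x (rfl | rfl)
    · simp only [iteratedDeriv_succ, iteratedDeriv_zero, deriv_oddMode, deriv_evenMode,
        oddMode_neg] at b2 ⊢
      rw [b2, neg_zero]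
    · exact b2
  · rintro x (rfl | rfl)
    · simp only [iteratedDeriv_succ, iteratedDeriv_zero, deriv_oddMode, deriv_evenMode,
        evenMode_neg] at b3 ⊢
      exact b3
    · exact b3
  · by_contra! h
    rw [h.1] at hα
    rw [h.2] at hβ
    have : (p ^ 2 + q ^ 2) ^ 2 * C = 0 := by
      linear_combination -(p ^ 2 - q ^ 2) * hα - 2 * p * q * hβ
    exact mul_ne_zero (by positivity) hC0 this

/-- For small negative tension there is a negative eigenvalue. -/
theorem exists_neg_mem_freeSpectrum_one {σ : ℝ} (hσ : σ < 0) (hσ' : -1 < σ) :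
    ∃ μ ∈ freeSpectrum 1 σ, μ < 0 := by
  obtain ⟨δ, hδ⟩ : ∃ δ, δ = -σ / 2 := ⟨_, rfl⟩
  have hδ0 : 0 < δ := by linarith
  have hπ := Real.pi_gt_three
  -- With `p² = q² - δ` the tension is `σ`. At `q₀` one has `3p² = q²`, which removes the `sinh`
  -- term of `F`; at `π/2` the `sin` term vanishes. The surviving terms have opposite signs.
  obtain ⟨q₀, hq₀⟩ : ∃ q₀, q₀ = Real.sqrt (3 * δ / 2) := ⟨_, rfl⟩
  have hq₀p : 0 < q₀ := hq₀ ▸ Real.sqrt_pos.2 (by linarith)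
  have hq₀s : q₀ ^ 2 = 3 * δ / 2 := hq₀ ▸ Real.sq_sqrt (by linarith)
  have hle : q₀ ≤ Real.pi / 2 := by nlinarith
  let F : ℝ → ℝ := fun q => (Real.sqrt (q ^ 2 - δ) ^ 3 - 3 * Real.sqrt (q ^ 2 - δ) * q ^ 2) *
    Real.sin (2 * q) + (3 * Real.sqrt (q ^ 2 - δ) ^ 2 * q - q ^ 3) *
      Real.sinh (2 * Real.sqrt (q ^ 2 - δ))
  have hF : ContinuousOn F (Icc q₀ (Real.pi / 2)) := by
    apply Continuous.continuousOn
    fun_prop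
  have hs : ∀ q, q₀ ≤ q → Real.sqrt (q ^ 2 - δ) ^ 2 = q ^ 2 - δ ∧ 0 < Real.sqrt (q ^ 2 - δ) := by
    intro q hq
    have : 0 < q ^ 2 - δ := by nlinarith
    exact ⟨Real.sq_sqrt this.le, Real.sqrt_pos.2 this⟩
  have hlow : F q₀ ≤ 0 := by
    obtain ⟨h1, h2⟩ := hs q₀ le_rfl
    have hsin : 0 ≤ Real.sin (2 * q₀) :=
      Real.sin_nonneg_of_nonneg_of_le_pi (by linarith) (by linarith)
    simp only [F]
    set r := Real.sqrt (q₀ ^ 2 - δ)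
    have e1 : 3 * r ^ 2 * q₀ - q₀ ^ 3 = 0 := by
      linear_combination 3 * q₀ * h1 + 2 * q₀ * hq₀s
    have e2 : r ^ 3 - 3 * r * q₀ ^ 2 = -(r * (2 * q₀ ^ 2 + δ)) := by
      linear_combination r * h1
    rw [e1, e2, zero_mul, add_zero, neg_mul]
    exact neg_nonpos.2 (by positivity)
  have hhigh : 0 ≤ F (Real.pi / 2) := by
    obtain ⟨h1, h2⟩ := hs _ hle
    simp only [F]
    rw [mul_div_cancel₀ _ two_ne_zero, Real.sin_pi, mul_zero, zero_add]
    refine mul_nonneg ?_ (Real.sinh_nonneg_iff.2 (by positivity))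
    have : 3 * Real.sqrt ((Real.pi / 2) ^ 2 - δ) ^ 2 * (Real.pi / 2) - (Real.pi / 2) ^ 3 =
        (Real.pi / 2) * (2 * (Real.pi / 2) ^ 2 - 3 * δ) := by
      linear_combination 3 * (Real.pi / 2) * h1
    rw [this]
    exact mul_nonneg (by positivity) (by nlinarith)
  obtain ⟨q, hq, hroot⟩ := intermediate_value_Icc hle hF ⟨hlow, hhigh⟩
  obtain ⟨h1, h2⟩ := hs q hq.1
  have hqp : 0 < q := hq₀p.trans_le hq.1
  have hmem := neg_mem_freeSpectrum_of_root h2.ne' hqp.ne'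
    (Real.sin_pos_of_pos_of_lt_pi hqp (by linarith [hq.2])).ne' hroot
  rw [h1] at hmem
  refine ⟨_, ?_, neg_neg_of_pos (pow_pos (?_ : 0 < q ^ 2 - δ + q ^ 2) 2)⟩
  · convert hmem using 2
    rw [hδ]; ring
  · rw [← h1]; positivity

theorem exists_neg_mem_freeSpectrum {R τ : ℝ} (hR : 0 < R) (hτ : τ < 0) (hτ' : -1 < τ * R ^ 2) :
    ∃ μ ∈ freeSpectrum R τ, μ < 0 := by
  obtain ⟨μ, hμ, hneg⟩ := exists_neg_mem_freeSpectrum_one (mul_neg_of_neg_of_pos hτ (pow_pos hR 2))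
    hτ'
  refine ⟨_, ?_, mul_neg_of_neg_of_pos hneg (pow_pos (inv_pos.2 hR) 4)⟩
  convert mem_freeSpectrum_dilate (inv_pos.2 hR) hμ using 1
  field_simp

/-! ### Growth rates -/

/-- Growth rates solve `λ² - Tλ + Δ = 0` with `T` and `Δ` the trace and determinant of `M - μD`;
here `T ≤ 0` and `Δ = k(μ - a)(μ - b) ≥ 0`. A root with positive real part would be real, making the
left side positive. -/
theorem re_nonpos_of_isGrowthRate {p : Params} (hk : 0 < p.k) (hd : 0 ≤ p.disc) {μ : ℝ}
    (hA : p.A ≤ μ) (hab : (μ - p.a) * (μ - p.b) ≥ 0) {lam : ℂ} (h : IsGrowthRate p μ lam) :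
    lam.re ≤ 0 := by
  have hT : p.fu + p.gv - (1 + p.k) * μ ≤ 0 := by
    rw [Params.A, div_le_iff₀ (by linarith)] at hA
    linarith
  have hfac : (μ - p.fu) * (p.k * μ - p.gv) - p.fv * p.gu = p.k * ((μ - p.a) * (μ - p.b)) := by
    have hs := Real.sq_sqrt hd
    rw [Params.a, Params.b]
    field_simp
    rw [Params.disc] at hs ⊢
    linear_combination hs
  have hΔ : 0 ≤ (μ - p.fu) * (p.k * μ - p.gv) - p.fv * p.gu := by
    rw [hfac]; exact mul_nonneg hk.le hab
  have hre := congrArg Complex.re h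
  have him := congrArg Complex.im h
  simp [Matrix.det_fin_two, Params.D, Params.M] at hre him
  by_contra! hpos
  have hy : lam.im = 0 := by
    refine (mul_eq_zero.1 (?_ : (2 * lam.re - (p.fu + p.gv - (1 + p.k) * μ)) * _ = 0)).resolve_left
      (by linarith)
    linear_combination him
  rw [hy] at hre
  nlinarith [mul_pos hpos hpos, mul_nonneg hpos.le (neg_nonneg.2 hT)]

/-! ### The region outside the Turing space -/

theorem Params.A_neg {p : Params} (hk : 0 < p.k) (h1 : p.fu + p.gv < 0) : p.A < 0 :=
  div_neg_of_neg_of_pos h1 (by linarith)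

theorem Params.a_pos {p : Params} (hk : 0 < p.k) (h2 : 0 < p.fu * p.gv - p.fv * p.gu)
    (h4 : 0 < p.k * p.fu + p.gv) : 0 < p.a := by
  refine div_pos (sub_pos.2 ((Real.sqrt_lt' h4).2 ?_)) (by linarith)
  rw [Params.disc]
  nlinarith [mul_pos hk h2]

theorem Params.a_le_b {p : Params} (hk : 0 < p.k) : p.a ≤ p.b := by
  have := Real.sqrt_nonneg p.disc
  exact div_le_div_of_nonneg_right (by linarith) (by linarith)

/-- If `μ` lies in `[4σ, 0] ∪ [1/100, ∞)` with `σ = τ R²`, and `R` and `τ / R²` are small, then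
`μ / R⁴` avoids both the range `(a, b)` and the range below `A`. -/
theorem rescaled_mem {A b R τ μ : ℝ} (hR : 0 < R) (hτ : A * R ^ 2 / 4 < τ)
    (hb : b * R ^ 4 < 1 / 100) (hA : A ≤ 0) (hμ : μ ∈ Icc (4 * (τ * R ^ 2)) 0 ∪ Ici (1 / 100)) :
    A ≤ (R ^ 4)⁻¹ * μ ∧ ((R ^ 4)⁻¹ * μ ≤ 0 ∨ b ≤ (R ^ 4)⁻¹ * μ) := by
  have hR4 : 0 < R ^ 4 := pow_pos hR 4
  rw [← div_eq_inv_mul, le_div_iff₀ hR4, le_div_iff₀ hR4]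
  rcases hμ with ⟨hl, hu⟩ | hμ
  · refine ⟨?_, Or.inl (div_nonpos_of_nonpos_of_nonneg hu hR4.le)⟩
    have := mul_lt_mul_of_pos_right hτ (pow_pos hR 2)
    linarith
  · rw [mem_Ici] at hμ
    exact ⟨(mul_nonpos_of_nonpos_of_nonneg hA hR4.le).trans (by linarith), Or.inr (by linarith)⟩

/-- The region `0 < R < ρ`, `A R² / 4 < τ < 0`. -/
def quietRegion (A ρ : ℝ) : Set (ℝ × ℝ) :=
  {q | (0 < q.1 ∧ q.1 < ρ) ∧ A * q.1 ^ 2 / 4 < q.2 ∧ q.2 < 0}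

theorem isOpen_quietRegion (A ρ : ℝ) : IsOpen (quietRegion A ρ) :=
  ((isOpen_lt continuous_const continuous_fst).inter
    (isOpen_lt continuous_fst continuous_const)).inter
    ((isOpen_lt (by fun_prop) continuous_snd).inter (isOpen_lt continuous_snd continuous_const))

/-- Writing `τ` as a fraction of `A R²/4` straightens the region to a rectangle; connectedness and
the limit point at the origin then follow by continuity. -/
theorem quietRegion_eq_image {A : ℝ} (hA : A < 0) (ρ : ℝ) :
    quietRegion A ρ =
      (fun x : ℝ × ℝ => (x.1, x.2 * (A * x.1 ^ 2 / 4))) '' (Ioo 0 ρ ×ˢ Ioo 0 1) := by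
  ext ⟨R, τ⟩
  simp only [quietRegion, mem_ofPred_eq, mem_image, Prod.exists, mem_prod, mem_Ioo, Prod.mk.injEq]
  constructor
  · rintro ⟨hR, h1, h2⟩
    have hneg : A * R ^ 2 / 4 < 0 := by
      have := mul_neg_of_neg_of_pos hA (pow_pos hR.1 2)
      linarith
    refine ⟨R, τ / (A * R ^ 2 / 4), ⟨hR, div_pos_of_neg_of_neg h2 hneg, ?_⟩, rfl,
      div_mul_cancel₀ _ hneg.ne⟩
    rw [div_lt_one_of_neg hneg]
    exact h1
  · rintro ⟨R', s, ⟨hR, hs0, hs1⟩, rfl, rfl⟩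
    have hneg : A * R' ^ 2 / 4 < 0 := by
      have := mul_neg_of_neg_of_pos hA (pow_pos hR.1 2)
      linarith
    exact ⟨hR, by nlinarith, mul_neg_of_pos_of_neg hs0 hneg⟩

theorem isConnected_quietRegion {A ρ : ℝ} (hA : A < 0) (hρ : 0 < ρ) :
    IsConnected (quietRegion A ρ) := by
  rw [quietRegion_eq_image hA]
  exact ((isConnected_Ioo hρ).prod (isConnected_Ioo one_pos)).image _
    (Continuous.continuousOn (by fun_prop))

theorem zero_mem_closure_quietRegion {A ρ : ℝ} (hA : A < 0) (hρ : 0 < ρ) :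
    ((0 : ℝ), (0 : ℝ)) ∈ closure (quietRegion A ρ) := by
  have hc : Continuous fun x : ℝ × ℝ => (x.1, x.2 * (A * x.1 ^ 2 / 4)) := by fun_prop
  rw [quietRegion_eq_image hA]
  refine image_closure_subset_closure_image hc ⟨(0, 0), ?_, by simp⟩
  rw [closure_prod_eq, closure_Ioo hρ.ne, closure_Ioo one_ne_zero.symm]
  exact ⟨⟨le_rfl, hρ.le⟩, ⟨le_rfl, zero_le_one⟩⟩

end FourthOrderTuring

theorem corollary3p5 (p : Params) (hk : 0 < p.k)
    (h1 : p.fu + p.gv < 0)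
    (h2 : 0 < p.fu * p.gv - p.fv * p.gu)
    (h3 : 0 < (p.k * p.fu + p.gv) ^ 2 - 4 * p.k * (p.fu * p.gv - p.fv * p.gu))
    (h4 : 0 < p.k * p.fu + p.gv) :
    ∃ U : Set (ℝ × ℝ), IsOpen U ∧ IsConnected U ∧
      (∀ q ∈ U, 0 < q.1 ∧ q.2 < 0) ∧
      ((0 : ℝ), (0 : ℝ)) ∈ closure U ∧
      Disjoint U (⋃ l : ℕ, regionE p l ∪ regionO p l) ∧
      ∀ q ∈ U, (∃ μ ∈ freeSpectrum q.1 q.2, μ < 0) ∧ q ∉ turingSpace p := by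
  have hA := Params.A_neg hk h1
  have ha := Params.a_pos hk h2 h4
  have hab := Params.a_le_b hk
  have hpos : 0 < 1 + p.b - p.A := by linarith
  -- Since `R⁴ < ρ`, one choice makes both `b R⁴ < 1/100` and `|σ| < -A R⁴/4 < 1/200`; the summand
  -- `1` ensures `ρ ≤ 1`.
  obtain ⟨ρ, hρ⟩ : ∃ ρ, ρ = 1 / (100 * (1 + p.b - p.A)) := ⟨_, rfl⟩
  have hρ0 : 0 < ρ := hρ ▸ by positivity
  have hρm : ρ * (1 + p.b - p.A) = 1 / 100 := by rw [hρ]; field_simp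
  have small : ∀ R τ : ℝ, (R, τ) ∈ quietRegion p.A ρ →
      p.b * R ^ 4 < 1 / 100 ∧ τ * R ^ 2 < 0 ∧ -(1 / 200) < τ * R ^ 2 := by
    rintro R τ ⟨⟨hR, hRρ⟩, hτ, hτ0⟩
    simp only at hR hRρ hτ hτ0
    have hρ1 : ρ ≤ 1 := by nlinarith
    have hR4 : R ^ 4 < ρ :=
      (pow_le_of_le_one hR.le (hRρ.le.trans hρ1) (by norm_num)).trans_lt hRρ
    have hR4p : 0 < R ^ 4 := pow_pos hR 4
    have hτR := mul_lt_mul_of_pos_right hτ (pow_pos hR 2)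
    exact ⟨by nlinarith, mul_neg_of_neg_of_pos hτ0 (pow_pos hR 2), by nlinarith⟩
  refine ⟨quietRegion p.A ρ, isOpen_quietRegion _ _, isConnected_quietRegion hA hρ0,
    fun q hq => ⟨hq.1.1, hq.2.2⟩, zero_mem_closure_quietRegion hA hρ0, ?_, ?_⟩
  · rw [Set.disjoint_left]
    rintro ⟨R, τ⟩ hq hmem
    obtain ⟨hbR, hσ, hσ'⟩ := small R τ hq
    have hC : ∀ S ⊆ freeSpectrum 1 (τ * R ^ 2), ∀ l,
        increasingList S l ∈ Icc (4 * (τ * R ^ 2)) 0 ∪ Ici (1 / 100) := by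
      intro S hS l
      refine increasingList_mem (fun μ hμ => mem_of_mem_freeSpectrum_one hσ hσ' (hS hμ))
        (isClosed_Icc.union isClosed_Ici) (Or.inl ⟨by linarith, le_rfl⟩)
        (bddBelow_Icc.union bddBelow_Ici) l
    have bad : ∀ μ ∈ Icc (4 * (τ * R ^ 2)) 0 ∪ Ici (1 / 100),
        ¬ ((R ^ 4)⁻¹ * μ ∈ Ioo p.a p.b) ∧ ¬ ((R ^ 4)⁻¹ * μ < p.A) := by
      intro μ hμ
      obtain ⟨hl, hr⟩ := rescaled_mem hq.1.1 hq.2.1 hbR hA.le hμ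
      exact ⟨fun hm => hr.elim (fun h => by linarith [hm.1]) fun h => by linarith [hm.2],
        not_lt.2 hl⟩
    obtain ⟨l, hE | hO⟩ := mem_iUnion.1 hmem
    · have hb := bad _ (hC _ (evenSpectrum_subset _) l)
      exact hE.elim (fun h => hb.1 h.2) fun h => hb.2 h.2.1
    · have hb := bad _ (hC _ (oddSpectrum_subset _) l)
      exact hO.elim (fun h => hb.1 h.2) fun h => hb.2 h.2.1
  · rintro ⟨R, τ⟩ hq
    obtain ⟨hbR, hσ, hσ'⟩ := small R τ hq
    have hR : 0 < R := hq.1.1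
    refine ⟨exists_neg_mem_freeSpectrum hR hq.2.2 (by linarith), ?_⟩
    -- The gap holds for the whole spectrum, so this `μ` need not be matched with a branch.
    rintro ⟨-, -, μ, hμ, lam, hlam, hre⟩
    have hμ1 := mem_freeSpectrum_dilate hR hμ
    rw [div_self hR.ne'] at hμ1
    obtain ⟨hl, hr⟩ := rescaled_mem hR hq.2.1 hbR hA.le (mem_of_mem_freeSpectrum_one hσ hσ' hμ1)
    have hμe : (R ^ 4)⁻¹ * (μ * R ^ 4) = μ := by field_simp
    rw [hμe] at hl hr
    refine (re_nonpos_of_isGrowthRate hk h3.le hl ?_ hlam).not_gt hre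
    rcases hr with h | h
    · exact mul_nonneg_of_nonpos_of_nonpos (by linarith) (by linarith)
    · exact mul_nonneg (by linarith) (by linarith)
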